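/- A \emph{square grid graph} is the graph $G$ induced by the square lattice on a finite set $V\subset\mathbb{Z}^2$: two points of $V$ are adjacent exactly when their Euclidean distance is $1$. Consider the faces of $G$, drawn in the plane with straight edges. A bounded face is a \emph{hole} if it contains a lattice point in its interior, and a \emph{pixel} otherwise (a pixel is then a unit square all four corners of which are in $V$). The border of the unbounded face is the \emph{outer boundary} of $G$; the borders of the holes are the \emph{inner boundaries}; a vertex on one of these boundaries is a \emph{boundary vertex}. The graph $G$ is \emph{polygonal} if every vertex and every edge of $G$ belongs to a pixel and there is no vertex whose removal merges two different boundaries (that is, makes two different faces, each of them the unbounded face or a hole, part of one face). It is \emph{thin} if every vertex is a boundary vertex. \textbf{Theorem.} Every connected square grid graph that has no cut vertex and is polygonal and thin has a Hamiltonian cycle. \textbf{Corollary.} Consider the problem whose instances are the connected, polygonal and thin square grid graphs without cut vertices, and which asks whether a given instance is Hamiltonian. The algorithm that accepts every input decides this problem, and it runs in polynomial time: for every encoding of the instances as strings over a finite alphabet, there is a multi-stack Turing machine that computes the constant answer "true" on every instance, in a number of steps bounded by a polynomial in the length of the encoded instance. -/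

import Mathlib

/-- The infinite square lattice: the points of `ℤ × ℤ`, two of them being adjacent when they are
at Euclidean distance `1`. -/
def squareLattice : SimpleGraph (ℤ × ℤ) where
  Adj u v := (u.1 - v.1) ^ 2 + (u.2 - v.2) ^ 2 = 1
  symm := ⟨fun u v h => by
    have e : (v.1 - u.1) ^ 2 + (v.2 - u.2) ^ 2 = (u.1 - v.1) ^ 2 + (u.2 - v.2) ^ 2 := by ring
    exact e.trans h⟩
  loopless := ⟨fun u h => by simp at h⟩

namespace SquareGrid

/-- The square grid graph on a finite set `V` of lattice points: the subgraph of the square lattice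
induced by `V`. -/
def graph (V : Finset (ℤ × ℤ)) : SimpleGraph V :=
  squareLattice.comap Subtype.val

/-- The four corners of the unit square (cell) `c`, where a cell is named by its lower left
corner. -/
def corners (c : ℤ × ℤ) : Finset (ℤ × ℤ) :=
  {(c.1, c.2), (c.1 + 1, c.2), (c.1, c.2 + 1), (c.1 + 1, c.2 + 1)}

/-- Two cells are adjacent when they share a side (their lower left corners are at distance `1`)
and this side is not an edge of the grid graph on `V`. The end points of the common side are the
two common corners of the cells, and the side is an edge of the (induced) grid graph exactly when
both of them are in `V`. So one can cross from one cell to the other without meeting the drawing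
of the graph. -/
def cellGraph (V : Finset (ℤ × ℤ)) : SimpleGraph (ℤ × ℤ) where
  Adj c d := squareLattice.Adj c d ∧ ¬ corners c ∩ corners d ⊆ V
  symm := ⟨fun c d h => ⟨squareLattice.symm.symm _ _ h.1, by
    rw [Finset.inter_comm]; exact h.2⟩⟩
  loopless := ⟨fun c h => squareLattice.loopless.irrefl c h.1⟩

/-- A face of the plane drawing of the grid graph on `V`, given by the unit cells that it
contains: a maximal set of cells that are joined across sides that are not edges of the graph. -/
abbrev Face (V : Finset (ℤ × ℤ)) : Type :=
  (cellGraph V).ConnectedComponent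

variable {V : Finset (ℤ × ℤ)}

/-- A face is bounded when it consists of finitely many cells. -/
def Face.IsBounded (f : Face V) : Prop :=
  f.supp.Finite

/-- The lattice point `w` lies in the interior of the face `f`: it is not a vertex of the graph,
and the four cells around it belong to `f`. -/
def Face.HasInteriorPoint (f : Face V) (w : ℤ × ℤ) : Prop :=
  w ∉ V ∧ ∀ c, w ∈ corners c → c ∈ f.supp

/-- A hole is a bounded face that contains a lattice point in its interior. -/
def Face.IsHole (f : Face V) : Prop :=
  f.IsBounded ∧ ∃ w, f.HasInteriorPoint w

/-- A pixel is a bounded face that contains no lattice point in its interior. -/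
def Face.IsPixel (f : Face V) : Prop :=
  f.IsBounded ∧ ¬ ∃ w, f.HasInteriorPoint w

/-- The faces whose borders are the boundaries of the graph: the unbounded face (its border is the
outer boundary) and the holes (their borders are the inner boundaries). -/
def Face.BordersBoundary (f : Face V) : Prop :=
  ¬ f.IsBounded ∨ f.IsHole

/-- The lattice point `v` lies on the border of the face `f`. -/
def Face.VertexOnBorder (f : Face V) (v : ℤ × ℤ) : Prop :=
  ∃ c ∈ f.supp, v ∈ corners c

/-- The edge `uv` of the lattice lies on the border of the face `f`, that is, it is a side of a
cell of `f`. -/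
def Face.EdgeOnBorder (f : Face V) (u v : ℤ × ℤ) : Prop :=
  ∃ c ∈ f.supp, u ∈ corners c ∧ v ∈ corners c

variable (V)

/-- Removing the vertex `v` merges two different boundaries: two different faces of the graph, each
of them the unbounded face or a hole, become part of one face when `v` is removed. -/
def MergesBoundaries (v : ℤ × ℤ) : Prop :=
  ∃ f g : Face V, f ≠ g ∧ f.BordersBoundary ∧ g.BordersBoundary ∧
    ∃ c ∈ f.supp, ∃ d ∈ g.supp, (cellGraph (V.erase v)).Reachable c d

/-- Polygonal: every vertex and every edge belongs to a pixel, and no vertex can be removed to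
merge two boundaries. -/
structure IsPolygonal : Prop where
  vertex_mem_pixel : ∀ v ∈ V, ∃ f : Face V, f.IsPixel ∧ f.VertexOnBorder v
  edge_mem_pixel : ∀ u ∈ V, ∀ v ∈ V, squareLattice.Adj u v →
    ∃ f : Face V, f.IsPixel ∧ f.EdgeOnBorder u v
  not_merges : ∀ v ∈ V, ¬ MergesBoundaries V v

/-- A boundary vertex is a vertex on the outer boundary or on an inner boundary. -/
def IsBoundaryVertex (v : ℤ × ℤ) : Prop :=
  v ∈ V ∧ ∃ f : Face V, f.BordersBoundary ∧ f.VertexOnBorder v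

/-- Thin: every vertex is a boundary vertex. -/
def IsThin : Prop :=
  ∀ v ∈ V, IsBoundaryVertex V v

/-- No cut vertex: removing a vertex does not disconnect the graph. -/
def HasNoCutVertex : Prop :=
  ∀ v ∈ V, (graph (V.erase v)).Preconnected

/-- The instances of the Hamiltonicity problem for square polygonal thin grid graphs: connected,
without cut vertices, polygonal and thin. -/
structure IsPolygonalThin : Prop where
  connected : (graph V).Connected
  noCutVertex : HasNoCutVertex V
  polygonal : IsPolygonal V
  thin : IsThin V

/-- The type of all square polygonal thin grid graphs, each given by its vertex set. -/
abbrev PolygonalThin : Type :=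
  {V : Finset (ℤ × ℤ) // IsPolygonalThin V}

end SquareGrid

/-- The `always accept` algorithm. -/
def alwaysAccept {α : Type} : α → Bool :=
  fun _ => true

/-- The Boolean function `f` decides the property `P` of the objects of type `α`, and it is
computed by a Turing machine (with several stacks, the objects being given as the strings `enc a`)
in a number of steps that is polynomial in the length of the input string. -/
def DecidesInPolyTime {α Γ : Type} (enc : Computability.Encoding α Γ) (f : α → Bool)
    (P : α → Prop) : Prop :=
  (∀ a, f a = true ↔ P a) ∧
    Nonempty (Turing.TM2ComputableInPolyTime enc.encode Computability.encodeBool f)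

/-!
Call a cell a pixel if its four corners are vertices. As the graph is thin and no vertex merges two
boundaries, each vertex touches exactly one face that is not a pixel. As there is no cut vertex, the
pixels around a vertex form an arc: if two opposite cells were pixels and the other two were not,
a cycle straight through the vertex would separate the other two, although they belong to one face
(`not_reachable_opposite`). Hence the edges between pixels and nonpixels form a 2-factor `B` of the
graph, and by a similar separation argument the vertices on the border of one face are joined in `B`
(`IsPolygonalThin.reachable_boundaryGraph`): the cycles of `B` are the borders of the faces. In
place of the Jordan curve theorem it suffices that every mod 2 cycle of lattice edges bounds a
two-colouring of the cells (`exists_coloring`).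

The border cycles are merged into one. Consider a face other than the outer one and its rightmost
column. Next to this column there is a pixel whose left side borders the face, whose right side
borders another face, and whose upper and lower neighbours are pixels
(`IsPolygonalThin.exists_isExit`). Removing this pixel from the pixel region exchanges its two
vertical sides for its two horizontal sides in the boundary of the region, and thereby merges the
borders of the two faces (`reachable_of_flip`). The other face extends further to the right, so the
faces form a tree rooted at the outer face. The pixels chosen for different faces do not interfere,
because each vertex touches only one face. When all of them are removed, the boundary of the
remaining region is still 2-regular and passes through every vertex, and it is connected
(`IsPolygonalThin.cutRegion_spec`): it is a Hamiltonian cycle.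

The statement about polynomial time is then witnessed by a machine that empties its input stack and
writes `true`.
-/

namespace SquareGrid

/-! ### Mod 2 chains of lattice edges and two-colourings of the cells -/

theorem squareLattice_adj_iff {u v : ℤ × ℤ} : squareLattice.Adj u v ↔
    v = (u.1 + 1, u.2) ∨ v = (u.1 - 1, u.2) ∨ v = (u.1, u.2 + 1) ∨ v = (u.1, u.2 - 1) := by
  obtain ⟨a, b⟩ := u
  obtain ⟨c, d⟩ := v
  simp only [squareLattice, Prod.mk.injEq]
  constructor
  · intro h
    obtain ⟨p, hp⟩ : ∃ p, p = a - c := ⟨_, rfl⟩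
    obtain ⟨q, hq⟩ : ∃ q, q = b - d := ⟨_, rfl⟩
    rw [← hp, ← hq] at h
    have h1 : p ≤ 1 := by nlinarith [sq_nonneg q]
    have h2 : -1 ≤ p := by nlinarith [sq_nonneg q]
    have h3 : q ≤ 1 := by nlinarith [sq_nonneg p]
    have h4 : -1 ≤ q := by nlinarith [sq_nonneg p]
    interval_cases p <;> interval_cases q <;> omega
  · rintro (⟨rfl, rfl⟩ | ⟨rfl, rfl⟩ | ⟨rfl, rfl⟩ | ⟨rfl, rfl⟩) <;> ring

theorem mem_corners {v c : ℤ × ℤ} :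
    v ∈ corners c ↔ (v.1 = c.1 ∨ v.1 = c.1 + 1) ∧ (v.2 = c.2 ∨ v.2 = c.2 + 1) := by
  obtain ⟨a, b⟩ := v
  obtain ⟨c, d⟩ := c
  simp only [corners, Finset.mem_insert, Finset.mem_singleton, Prod.mk.injEq]
  tauto

theorem mem_corners_iff_cell {x y : ℤ} {c : ℤ × ℤ} : (x, y) ∈ corners c ↔
    c = (x, y) ∨ c = (x - 1, y) ∨ c = (x - 1, y - 1) ∨ c = (x, y - 1) := by
  obtain ⟨a, b⟩ := c
  simp only [mem_corners, Prod.mk.injEq]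
  omega

theorem cellGraph_adj_left {V : Finset (ℤ × ℤ)} {x y : ℤ} :
    (cellGraph V).Adj (x - 1, y) (x, y) ↔ ¬ ((x, y) ∈ V ∧ (x, y + 1) ∈ V) := by
  have : corners (x - 1, y) ∩ corners (x, y) = {(x, y), (x, y + 1)} := by
    ext ⟨a, b⟩
    simp only [Finset.mem_inter, mem_corners, Finset.mem_insert, Finset.mem_singleton,
      Prod.mk.injEq]
    omega
  change squareLattice.Adj _ _ ∧ ¬ _ ↔ _
  rw [this, squareLattice_adj_iff]
  simp [Finset.insert_subset_iff]

theorem cellGraph_adj_down {V : Finset (ℤ × ℤ)} {x y : ℤ} :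
    (cellGraph V).Adj (x, y - 1) (x, y) ↔ ¬ ((x, y) ∈ V ∧ (x + 1, y) ∈ V) := by
  have : corners (x, y - 1) ∩ corners (x, y) = {(x, y), (x + 1, y)} := by
    ext ⟨a, b⟩
    simp only [Finset.mem_inter, mem_corners, Finset.mem_insert, Finset.mem_singleton,
      Prod.mk.injEq]
    omega
  change squareLattice.Adj _ _ ∧ ¬ _ ↔ _
  rw [this, squareLattice_adj_iff]
  simp [Finset.insert_subset_iff]

/-- A mod 2 cycle of lattice edges is the set of edges at which some two-colouring `κ` of the cells
changes. The value `h (x, y)` is the coefficient of the edge from `(x, y)` to `(x + 1, y)`, and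
`t (x, y)` that of the edge from `(x, y)` to `(x, y + 1)`; no edge starts at or to the left of
`x = M`. The colour of a cell counts the vertical edges of the cycle to the left of the cell. -/
theorem exists_coloring (h t : ℤ × ℤ → ZMod 2) (M : ℤ)
    (hM : ∀ x y, x ≤ M → h (x, y) = 0 ∧ t (x, y) = 0)
    (hc : ∀ x y, h (x, y) + h (x - 1, y) + t (x, y) + t (x, y - 1) = 0) :
    ∃ κ : ℤ × ℤ → ZMod 2, (∀ x y, κ (x, y) = κ (x - 1, y) + t (x, y)) ∧
      ∀ x y, κ (x, y) = κ (x, y - 1) + h (x, y) := by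
  let κ : ℤ × ℤ → ZMod 2 := fun c => ∑ i ∈ Finset.Ioc M c.1, t (i, c.2)
  have h1 : ∀ x y, κ (x, y) = κ (x - 1, y) + t (x, y) := by
    intro x y
    by_cases hx : x ≤ M
    · simp only [κ]
      rw [Finset.Ioc_eq_empty (by omega), Finset.Ioc_eq_empty (by omega), (hM x y hx).2]
      simp
    · have : Finset.Ioc M x = insert x (Finset.Ioc M (x - 1)) := by
        ext i; simp only [Finset.mem_Ioc, Finset.mem_insert]; omega
      simp only [κ]
      rw [this, Finset.sum_insert (by simp), add_comm]
  -- the difference of two rows is carried along from column `M` by the cycle condition `hc`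
  have h2 : ∀ y, ∀ n : ℕ, κ (M + n, y) = κ (M + n, y - 1) + h (M + n, y) := by
    intro y n
    induction n with
    | zero => simp [κ, (hM M y le_rfl).1]
    | succ n ih =>
      have e : M + ((n + 1 : ℕ) : ℤ) - 1 = M + n := by push_cast; ring
      have e1 := h1 (M + (n + 1 : ℕ)) y
      have e2 := h1 (M + (n + 1 : ℕ)) (y - 1)
      have e3 := hc (M + (n + 1 : ℕ)) y
      rw [e] at e1 e2 e3
      rw [e1, e2, ih]
      have two : (2 : ZMod 2) = 0 := rfl
      linear_combination e3 - (h (M + (n + 1 : ℕ), y) + t (M + (n + 1 : ℕ), y - 1)) * two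
  refine ⟨κ, h1, fun x y => ?_⟩
  by_cases hx : x ≤ M
  · simp only [κ]
    rw [Finset.Ioc_eq_empty (by omega), (hM x y hx).1]
    simp
  · have := h2 y (x - M).toNat
    rwa [show M + ((x - M).toNat : ℤ) = x by omega] at this

/-- A colouring that changes only at edges of the grid graph is constant on every face. -/
theorem coloring_eq_of_reachable {V : Finset (ℤ × ℤ)} {h t κ : ℤ × ℤ → ZMod 2}
    (hh : ∀ x y, h (x, y) ≠ 0 → (x, y) ∈ V ∧ (x + 1, y) ∈ V)
    (ht : ∀ x y, t (x, y) ≠ 0 → (x, y) ∈ V ∧ (x, y + 1) ∈ V)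
    (h1 : ∀ x y, κ (x, y) = κ (x - 1, y) + t (x, y))
    (h2 : ∀ x y, κ (x, y) = κ (x, y - 1) + h (x, y))
    {c d : ℤ × ℤ} (hcd : (cellGraph V).Reachable c d) : κ c = κ d := by
  have hl : ∀ x y, (cellGraph V).Adj (x - 1, y) (x, y) → κ (x - 1, y) = κ (x, y) := by
    intro x y ha
    rw [h1 x y, not_not.1 (fun hn => cellGraph_adj_left.1 ha (ht x y hn)), add_zero]
  have hd : ∀ x y, (cellGraph V).Adj (x, y - 1) (x, y) → κ (x, y - 1) = κ (x, y) := by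
    intro x y ha
    rw [h2 x y, not_not.1 (fun hn => cellGraph_adj_down.1 ha (hh x y hn)), add_zero]
  rw [SimpleGraph.reachable_iff_reflTransGen] at hcd
  induction hcd with
  | refl => rfl
  | @tail b c _ hbc ih =>
    rw [ih]
    obtain ⟨x, y⟩ := b
    rcases squareLattice_adj_iff.1 hbc.1 with rfl | rfl | rfl | rfl
    · simpa using hl (x + 1) y (by simpa using hbc)
    · exact (hl x y hbc.symm).symm
    · simpa using hd x (y + 1) (by simpa using hbc)
    · exact (hd x y hbc.symm).symm

/-- The edges of a path from `a` to `b` form a mod 2 chain with boundary `a + b`. -/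
theorem exists_chain_of_reachable {W : Finset (ℤ × ℤ)} {a b : W}
    (hab : (graph W).Reachable a b) : ∃ h t : ℤ × ℤ → ZMod 2,
    (∀ x y, h (x, y) ≠ 0 → (x, y) ∈ W ∧ (x + 1, y) ∈ W) ∧
    (∀ x y, t (x, y) ≠ 0 → (x, y) ∈ W ∧ (x, y + 1) ∈ W) ∧
    ∀ x y, h (x, y) + h (x - 1, y) + t (x, y) + t (x, y - 1) =
      (if (x, y) = a.1 then 1 else 0) + if (x, y) = b.1 then 1 else 0 := by
  rw [SimpleGraph.reachable_iff_reflTransGen] at hab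
  induction hab with
  | refl =>
    refine ⟨0, 0, by simp, by simp, fun x y => ?_⟩
    simp [CharTwo.add_self_eq_zero]
  | @tail b c _ hbc ih =>
    obtain ⟨h, t, hh, ht, hc⟩ := ih
    obtain ⟨⟨u, v⟩, hb⟩ := b
    obtain ⟨⟨u', v'⟩, hcW⟩ := c
    have two : (2 : ZMod 2) = 0 := rfl
    -- the chain is extended by the edge between the last two vertices of the path
    have hor : ∀ p q : ℤ, (p, q) ∈ W → (p + 1, q) ∈ W →
        (∀ x y, ((if (x, y) = (u, v) then (1 : ZMod 2) else 0) +
          if (x, y) = (u', v') then (1 : ZMod 2) else 0) = (if (x, y) = (p, q) then 1 else 0) +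
          if (x, y) = (p + 1, q) then 1 else 0) → ∃ h t : ℤ × ℤ → ZMod 2,
          (∀ x y, h (x, y) ≠ 0 → (x, y) ∈ W ∧ (x + 1, y) ∈ W) ∧
          (∀ x y, t (x, y) ≠ 0 → (x, y) ∈ W ∧ (x, y + 1) ∈ W) ∧
          ∀ x y, h (x, y) + h (x - 1, y) + t (x, y) + t (x, y - 1) =
            (if (x, y) = a.1 then 1 else 0) + if (x, y) = (u', v') then 1 else 0 := by
      intro p q hp hp' e
      refine ⟨fun c => h c + if c = (p, q) then 1 else 0, t, fun x y hn => ?_, ht, fun x y => ?_⟩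
      · by_cases hxy : (x, y) = (p, q)
        · obtain ⟨rfl, rfl⟩ := Prod.mk.inj hxy
          exact ⟨hp, hp'⟩
        · exact hh x y (by simpa only [hxy, if_false, add_zero] using hn)
      · have e1 := hc x y
        have e2 := e x y
        have e3 : (if (x - 1, y) = (p, q) then (1 : ZMod 2) else 0) =
            if (x, y) = (p + 1, q) then 1 else 0 := by
          simp only [Prod.mk.injEq, sub_eq_iff_eq_add]
        simp only [e3]
        linear_combination e1 - e2 + (if (x, y) = (u, v) then (1 : ZMod 2) else 0) * two
    have ver : ∀ p q : ℤ, (p, q) ∈ W → (p, q + 1) ∈ W →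
        (∀ x y, ((if (x, y) = (u, v) then (1 : ZMod 2) else 0) +
          if (x, y) = (u', v') then (1 : ZMod 2) else 0) = (if (x, y) = (p, q) then 1 else 0) +
          if (x, y) = (p, q + 1) then 1 else 0) → ∃ h t : ℤ × ℤ → ZMod 2,
          (∀ x y, h (x, y) ≠ 0 → (x, y) ∈ W ∧ (x + 1, y) ∈ W) ∧
          (∀ x y, t (x, y) ≠ 0 → (x, y) ∈ W ∧ (x, y + 1) ∈ W) ∧
          ∀ x y, h (x, y) + h (x - 1, y) + t (x, y) + t (x, y - 1) =
            (if (x, y) = a.1 then 1 else 0) + if (x, y) = (u', v') then 1 else 0 := by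
      intro p q hp hp' e
      refine ⟨h, fun c => t c + if c = (p, q) then 1 else 0, hh, fun x y hn => ?_, fun x y => ?_⟩
      · by_cases hxy : (x, y) = (p, q)
        · obtain ⟨rfl, rfl⟩ := Prod.mk.inj hxy
          exact ⟨hp, hp'⟩
        · exact ht x y (by simpa only [hxy, if_false, add_zero] using hn)
      · have e1 := hc x y
        have e2 := e x y
        have e3 : (if (x, y - 1) = (p, q) then (1 : ZMod 2) else 0) =
            if (x, y) = (p, q + 1) then 1 else 0 := by
          simp only [Prod.mk.injEq, sub_eq_iff_eq_add]
        simp only [e3]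
        linear_combination e1 - e2 + (if (x, y) = (u, v) then (1 : ZMod 2) else 0) * two
    have hadj : squareLattice.Adj (u, v) (u', v') := hbc
    rcases squareLattice_adj_iff.1 hadj with e | e | e | e <;>
      obtain ⟨rfl, rfl⟩ := Prod.mk.inj e
    · exact hor u v' hb hcW fun x y => rfl
    · exact hor (u - 1) v' hcW (by simpa using hb) fun x y => by
        simp only [sub_add_cancel]; exact add_comm _ _
    · exact ver u' v hb hcW fun x y => rfl
    · exact ver u' (v - 1) hcW (by simpa using hb) fun x y => by
        simp only [sub_add_cancel]; exact add_comm _ _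

/-! ### Pixels and faces -/

/-- The unit cells all of whose corners are vertices of the grid graph on `V`. -/
def pixels (V : Finset (ℤ × ℤ)) : Set (ℤ × ℤ) :=
  {c | corners c ⊆ V}

theorem mem_pixels {V : Finset (ℤ × ℤ)} {x y : ℤ} : (x, y) ∈ pixels V ↔
    (x, y) ∈ V ∧ (x + 1, y) ∈ V ∧ (x, y + 1) ∈ V ∧ (x + 1, y + 1) ∈ V := by
  simp [pixels, corners, Finset.insert_subset_iff]

/-- The four cells around a lattice point that is not a vertex lie in the same face. -/
theorem reachable_of_mem_corners {V : Finset (ℤ × ℤ)} {w c d : ℤ × ℤ} (hw : w ∉ V)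
    (hc : w ∈ corners c) (hd : w ∈ corners d) : (cellGraph V).Reachable c d := by
  obtain ⟨x, y⟩ := w
  have key : ∀ c, (x, y) ∈ corners c → (cellGraph V).Reachable c (x, y) := by
    intro c hc
    have h1 : (cellGraph V).Reachable (x - 1, y) (x, y) :=
      (cellGraph_adj_left.2 fun h => hw h.1).reachable
    rcases mem_corners_iff_cell.1 hc with rfl | rfl | rfl | rfl
    · rfl
    · exact h1
    · exact (cellGraph_adj_down.2 fun h => hw (by simpa using h.2)).reachable.trans h1
    · exact (cellGraph_adj_down.2 fun h => hw h.1).reachable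
  exact (key c hc).trans (key d hd).symm

/-- A pixel is a face by itself. -/
theorem eq_of_reachable_of_mem_pixels {V : Finset (ℤ × ℤ)} {c d : ℤ × ℤ} (hc : c ∈ pixels V)
    (h : (cellGraph V).Reachable c d) : d = c := by
  rw [SimpleGraph.reachable_iff_reflTransGen] at h
  induction h with
  | refl => rfl
  | tail _ hbc ih =>
    subst ih
    exact absurd (Finset.inter_subset_left.trans hc) hbc.2

theorem not_mem_pixels_of_reachable {V : Finset (ℤ × ℤ)} {c d : ℤ × ℤ} (hc : c ∉ pixels V)
    (h : (cellGraph V).Reachable c d) : d ∉ pixels V := fun hd =>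
  hc (eq_of_reachable_of_mem_pixels hd h.symm ▸ hd)

theorem hasInteriorPoint_of_not_mem_pixels {V : Finset (ℤ × ℤ)} {c : ℤ × ℤ} (hc : c ∉ pixels V) :
    ∃ w ∈ corners c, Face.HasInteriorPoint ((cellGraph V).connectedComponentMk c) w := by
  obtain ⟨w, hw, hwV⟩ := Finset.not_subset.1 hc
  exact ⟨w, hw, hwV, fun d hd =>
    SimpleGraph.ConnectedComponent.sound (reachable_of_mem_corners hwV hd hw)⟩

theorem bordersBoundary_of_not_mem_pixels {V : Finset (ℤ × ℤ)} {c : ℤ × ℤ} (hc : c ∉ pixels V) :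
    Face.BordersBoundary ((cellGraph V).connectedComponentMk c) := by
  obtain ⟨w, -, hw⟩ := hasInteriorPoint_of_not_mem_pixels hc
  by_cases hb : Face.IsBounded ((cellGraph V).connectedComponentMk c)
  · exact Or.inr ⟨hb, w, hw⟩
  · exact Or.inl hb

theorem mem_pixels_of_isPixel {V : Finset (ℤ × ℤ)} {f : Face V} (hf : f.IsPixel) {c : ℤ × ℤ}
    (hc : c ∈ f.supp) : c ∈ pixels V := by
  by_contra h
  obtain ⟨w, -, hw⟩ := hasInteriorPoint_of_not_mem_pixels h
  rw [show (cellGraph V).connectedComponentMk c = f from hc] at hw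
  exact hf.2 ⟨w, hw⟩

theorem not_mem_pixels_of_bordersBoundary {V : Finset (ℤ × ℤ)} {f : Face V}
    (hf : f.BordersBoundary) {c : ℤ × ℤ} (hc : c ∈ f.supp) : c ∉ pixels V := by
  intro h
  have hs : f.supp ⊆ {c} := fun d hd =>
    eq_of_reachable_of_mem_pixels h (SimpleGraph.ConnectedComponent.exact (hc.trans hd.symm))
  rcases hf with hf | ⟨-, w, hw, hcells⟩
  · exact hf ((Set.finite_singleton c).subset hs)
  · obtain ⟨x, y⟩ := w
    have e1 := hs (hcells (x, y) (mem_corners_iff_cell.2 (Or.inl rfl)))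
    have e2 := hs (hcells (x - 1, y) (mem_corners_iff_cell.2 (Or.inr (Or.inl rfl))))
    have := (show (x, y) = c from e1).trans (show (x - 1, y) = c from e2).symm
    simp at this
    omega

variable {V : Finset (ℤ × ℤ)} {v : ℤ × ℤ}

/-! ### The cells around a vertex -/

theorem IsPolygonalThin.exists_pixel (hV : IsPolygonalThin V) (hv : v ∈ V) :
    ∃ c ∈ pixels V, v ∈ corners c := by
  obtain ⟨f, hf, c, hc, hvc⟩ := hV.polygonal.vertex_mem_pixel v hv
  exact ⟨c, mem_pixels_of_isPixel hf hc, hvc⟩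

theorem IsPolygonalThin.exists_pixel_of_adj (hV : IsPolygonalThin V) {u : ℤ × ℤ} (hu : u ∈ V)
    (hv : v ∈ V) (huv : squareLattice.Adj u v) :
    ∃ c ∈ pixels V, u ∈ corners c ∧ v ∈ corners c := by
  obtain ⟨f, hf, c, hc, huvc⟩ := hV.polygonal.edge_mem_pixel u hu v hv huv
  exact ⟨c, mem_pixels_of_isPixel hf hc, huvc⟩

theorem IsPolygonalThin.exists_not_pixel (hV : IsPolygonalThin V) (hv : v ∈ V) :
    ∃ c ∉ pixels V, v ∈ corners c := by
  obtain ⟨-, f, hf, c, hc, hvc⟩ := hV.thin v hv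
  exact ⟨c, not_mem_pixels_of_bordersBoundary hf hc, hvc⟩

/-- The cells around a vertex that are not pixels lie in the same face: otherwise removing the vertex
would merge two boundaries. -/
theorem IsPolygonalThin.reachable_of_not_mem_pixels (hV : IsPolygonalThin V) (hv : v ∈ V)
    {c d : ℤ × ℤ} (hc : c ∉ pixels V) (hd : d ∉ pixels V) (hvc : v ∈ corners c)
    (hvd : v ∈ corners d) : (cellGraph V).Reachable c d := by
  by_contra h
  exact hV.polygonal.not_merges v hv ⟨_, _, fun e => h (SimpleGraph.ConnectedComponent.exact e),
    bordersBoundary_of_not_mem_pixels hc, bordersBoundary_of_not_mem_pixels hd, c, rfl, d, rfl,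
    reachable_of_mem_corners (Finset.notMem_erase v V) hvc hvd⟩

/-- Two cells that touch only in the middle vertex `(x, y)` of a straight path of the grid graph lie
in different faces. As `(x, y)` is not a cut vertex, its two neighbours on the path are joined by a
path that avoids `(x, y)`. It closes up to a cycle that passes straight through `(x, y)` and hence
separates the two cells. -/
theorem not_reachable_opposite (hV : HasNoCutVertex V) {x y : ℤ} (hv : (x, y) ∈ V)
    (he : (x + 1, y) ∈ V) (hw : (x - 1, y) ∈ V) :
    ¬ (cellGraph V).Reachable (x - 1, y) (x, y - 1) ∧
      ¬ (cellGraph V).Reachable (x, y) (x - 1, y - 1) := by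
  have he' : (x + 1, y) ∈ V.erase (x, y) := by simp [he]
  have hw' : (x - 1, y) ∈ V.erase (x, y) := by simp [hw]
  obtain ⟨h, t, hh, ht, hc⟩ := exists_chain_of_reachable (hV _ hv ⟨_, he'⟩ ⟨_, hw'⟩)
  obtain ⟨M, hM⟩ : ∃ M : ℤ, ∀ c ∈ V, M < c.1 := by
    obtain ⟨M, hM⟩ := (V.image Prod.fst).bddBelow
    exact ⟨M - 1, fun c hcV => by
      have := hM (Finset.mem_coe.2 (Finset.mem_image_of_mem Prod.fst hcV)); omega⟩
  -- the path from the east to the west neighbour is closed up through `(x, y)`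
  let h' : ℤ × ℤ → ZMod 2 := fun c =>
    h c + (if c = (x, y) then 1 else 0) + if c = (x - 1, y) then 1 else 0
  have hh' : ∀ p q, h' (p, q) ≠ 0 → (p, q) ∈ V ∧ (p + 1, q) ∈ V := by
    intro p q hn
    by_cases h1 : (p, q) = (x, y)
    · obtain ⟨rfl, rfl⟩ := Prod.mk.inj h1
      exact ⟨hv, he⟩
    by_cases h2 : (p, q) = (x - 1, y)
    · obtain ⟨rfl, rfl⟩ := Prod.mk.inj h2
      exact ⟨hw, by simpa using hv⟩
    have := hh p q (by simpa only [h', h1, h2, if_false, add_zero] using hn)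
    exact ⟨Finset.mem_of_mem_erase this.1, Finset.mem_of_mem_erase this.2⟩
  have ht' : ∀ p q, t (p, q) ≠ 0 → (p, q) ∈ V ∧ (p, q + 1) ∈ V := fun p q hn =>
    ⟨Finset.mem_of_mem_erase (ht p q hn).1, Finset.mem_of_mem_erase (ht p q hn).2⟩
  obtain ⟨κ, h1, h2⟩ := exists_coloring h' t M
    (fun p q hp => ⟨by_contra fun hn => by have := hM _ (hh' p q hn).1; simp at this; omega,
      by_contra fun hn => by have := hM _ (ht' p q hn).1; simp at this; omega⟩)
    (fun p q => by
      have e := hc p q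
      have two : (2 : ZMod 2) = 0 := rfl
      have e3 : (if (p - 1, q) = (x, y) then (1 : ZMod 2) else 0) =
          if (p, q) = (x + 1, y) then 1 else 0 := by
        simp only [Prod.mk.injEq, sub_eq_iff_eq_add]
      have e4 : (if (p - 1, q) = (x - 1, y) then (1 : ZMod 2) else 0) =
          if (p, q) = (x, y) then 1 else 0 := by
        simp only [Prod.mk.injEq, sub_left_inj]
      simp only [h', e3, e4]
      linear_combination e + ((if (p, q) = (x, y) then (1 : ZMod 2) else 0) +
        (if (p, q) = (x - 1, y) then (1 : ZMod 2) else 0) +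
        (if (p, q) = (x + 1, y) then (1 : ZMod 2) else 0)) * two)
  have t0 : t (x, y) = 0 := by_contra fun hn => by simpa using (ht x y hn).1
  have t1 : t (x, y - 1) = 0 := by_contra fun hn => by simpa using (ht x (y - 1) hn).2
  have hx : h' (x, y) = 1 := by
    have : h (x, y) = 0 := by_contra fun hn => by simpa using (hh x y hn).1
    simp [h', this, show x ≠ x - 1 by omega]
  have a1 := h1 x y
  have a2 := h1 x (y - 1)
  have a3 := h2 x y
  rw [t0, add_zero] at a1
  rw [t1, add_zero] at a2
  rw [hx] at a3
  constructor <;> intro hr <;> have e := coloring_eq_of_reachable hh' ht' h1 h2 hr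
  · rw [← a1, a3] at e; simp at e
  · rw [← a2, a3] at e; simp at e

/-- The region `R` has a regular boundary at `v`: the cells around `v` that belong to `R` form a
proper nonempty arc in the cyclic order. The last two conditions each exclude a pair of opposite
cells in `R` whose other two neighbours around `v` are both in `R` or both outside `R`. -/
def RegularAt (R : Set (ℤ × ℤ)) (v : ℤ × ℤ) : Prop :=
  (v ∈ R ∨ (v.1 - 1, v.2) ∈ R ∨ (v.1 - 1, v.2 - 1) ∈ R ∨ (v.1, v.2 - 1) ∈ R) ∧
  ¬ (v ∈ R ∧ (v.1 - 1, v.2 - 1) ∈ R ∧ ((v.1 - 1, v.2) ∈ R ↔ (v.1, v.2 - 1) ∈ R)) ∧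
  ¬ ((v.1 - 1, v.2) ∈ R ∧ (v.1, v.2 - 1) ∈ R ∧ (v ∈ R ↔ (v.1 - 1, v.2 - 1) ∈ R))

theorem IsPolygonalThin.regularAt_pixels (hV : IsPolygonalThin V) (hv : v ∈ V) :
    RegularAt (pixels V) v := by
  obtain ⟨x, y⟩ := v
  have h4 : ¬ ((x, y) ∈ pixels V ∧ (x - 1, y) ∈ pixels V ∧ (x - 1, y - 1) ∈ pixels V ∧
      (x, y - 1) ∈ pixels V) := by
    rintro ⟨h1, h2, h3, h4⟩
    obtain ⟨c, hc, hvc⟩ := hV.exists_not_pixel hv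
    rcases mem_corners_iff_cell.1 hvc with rfl | rfl | rfl | rfl <;> contradiction
  refine ⟨?_, ?_, ?_⟩
  · obtain ⟨c, hc, hvc⟩ := hV.exists_pixel hv
    rcases mem_corners_iff_cell.1 hvc with rfl | rfl | rfl | rfl <;> tauto
  · rintro ⟨h1, h2, h3⟩
    simp only at h2 h3
    have hb : (x - 1, y) ∉ pixels V := by tauto
    have hd : (x, y - 1) ∉ pixels V := by tauto
    refine (not_reachable_opposite hV.noCutVertex hv (mem_pixels.1 h1).2.1 ?_).1
      (hV.reachable_of_not_mem_pixels hv hb hd (by simp [mem_corners]) (by simp [mem_corners]))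
    simpa using (mem_pixels.1 h2).2.2.1
  · rintro ⟨h1, h2, h3⟩
    simp only at h1 h2 h3
    have hb : (x, y) ∉ pixels V := by tauto
    have hd : (x - 1, y - 1) ∉ pixels V := by tauto
    refine (not_reachable_opposite hV.noCutVertex hv ?_ (mem_pixels.1 h1).1).2
      (hV.reachable_of_not_mem_pixels hv hb hd (by simp [mem_corners]) (by simp [mem_corners]))
    simpa using (mem_pixels.1 h2).2.2.2

/-! ### The boundary of a region -/

/-- The edges of the lattice that separate a cell of `R` from a cell outside `R`. -/
def bdry (R : Set (ℤ × ℤ)) : SimpleGraph (ℤ × ℤ) where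
  Adj u v := squareLattice.Adj u v ∧
    ∃ c ∈ R, ∃ d ∉ R, (u ∈ corners c ∧ v ∈ corners c) ∧ u ∈ corners d ∧ v ∈ corners d
  symm := ⟨fun _ _ ⟨h, c, hc, d, hd, h1, h2⟩ => ⟨h.symm, c, hc, d, hd, h1.symm, h2.symm⟩⟩
  loopless := ⟨fun _ h => h.1.ne rfl⟩

variable {R : Set (ℤ × ℤ)}

theorem bdry_adj_right {x y : ℤ} :
    (bdry R).Adj (x, y) (x + 1, y) ↔ ¬ ((x, y) ∈ R ↔ (x, y - 1) ∈ R) := by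
  have key : ∀ c : ℤ × ℤ, (x, y) ∈ corners c ∧ (x + 1, y) ∈ corners c ↔
      c = (x, y) ∨ c = (x, y - 1) := by
    rintro ⟨a, b⟩
    simp only [mem_corners, Prod.mk.injEq]
    omega
  simp only [bdry, key, squareLattice_adj_iff]
  constructor
  · rintro ⟨-, c, hc, d, hd, rfl | rfl, rfl | rfl⟩ <;> tauto
  · intro h
    refine ⟨by simp, ?_⟩
    by_cases h1 : (x, y) ∈ R
    · exact ⟨_, h1, (x, y - 1), by tauto, by simp⟩
    · exact ⟨(x, y - 1), by tauto, _, h1, by simp⟩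

theorem bdry_adj_up {x y : ℤ} :
    (bdry R).Adj (x, y) (x, y + 1) ↔ ¬ ((x, y) ∈ R ↔ (x - 1, y) ∈ R) := by
  have key : ∀ c : ℤ × ℤ, (x, y) ∈ corners c ∧ (x, y + 1) ∈ corners c ↔
      c = (x, y) ∨ c = (x - 1, y) := by
    rintro ⟨a, b⟩
    simp only [mem_corners, Prod.mk.injEq]
    omega
  simp only [bdry, key, squareLattice_adj_iff]
  constructor
  · rintro ⟨-, c, hc, d, hd, rfl | rfl, rfl | rfl⟩ <;> tauto
  · intro h
    refine ⟨by simp, ?_⟩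
    by_cases h1 : (x, y) ∈ R
    · exact ⟨_, h1, (x - 1, y), by tauto, by simp⟩
    · exact ⟨(x - 1, y), by tauto, _, h1, by simp⟩

theorem bdry_adj_iff {x y : ℤ} {w : ℤ × ℤ} : (bdry R).Adj (x, y) w ↔
    (w = (x + 1, y) ∧ ¬ ((x, y) ∈ R ↔ (x, y - 1) ∈ R)) ∨
    (w = (x - 1, y) ∧ ¬ ((x - 1, y) ∈ R ↔ (x - 1, y - 1) ∈ R)) ∨
    (w = (x, y + 1) ∧ ¬ ((x, y) ∈ R ↔ (x - 1, y) ∈ R)) ∨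
    (w = (x, y - 1) ∧ ¬ ((x, y - 1) ∈ R ↔ (x - 1, y - 1) ∈ R)) := by
  have hl : (bdry R).Adj (x, y) (x - 1, y) ↔ ¬ ((x - 1, y) ∈ R ↔ (x - 1, y - 1) ∈ R) := by
    rw [SimpleGraph.adj_comm]
    simpa using bdry_adj_right (R := R) (x := x - 1) (y := y)
  have hd : (bdry R).Adj (x, y) (x, y - 1) ↔ ¬ ((x, y - 1) ∈ R ↔ (x - 1, y - 1) ∈ R) := by
    rw [SimpleGraph.adj_comm]
    simpa using bdry_adj_up (R := R) (x := x) (y := y - 1)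
  rw [← bdry_adj_right, ← bdry_adj_up, ← hl, ← hd]
  constructor
  · intro h
    rcases squareLattice_adj_iff.1 h.1 with rfl | rfl | rfl | rfl <;> tauto
  · rintro (⟨rfl, h⟩ | ⟨rfl, h⟩ | ⟨rfl, h⟩ | ⟨rfl, h⟩) <;> exact h

theorem mem_of_bdry_adj (hR : R ⊆ pixels V) {u v : ℤ × ℤ} (h : (bdry R).Adj u v) :
    u ∈ V ∧ v ∈ V := by
  obtain ⟨-, c, hc, -, -, h1, -⟩ := h
  exact ⟨hR hc h1.1, hR hc h1.2⟩

/-- The boundary of the region `R`, as a graph on the vertex set `V`. -/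
def boundaryGraph (V : Finset (ℤ × ℤ)) (R : Set (ℤ × ℤ)) : SimpleGraph V :=
  (bdry R).comap Subtype.val

theorem boundaryGraph_le : boundaryGraph V R ≤ graph V := fun _ _ h => h.1

theorem ncard_neighborSet_boundaryGraph (hR : R ⊆ pixels V) (v : V) (hv : RegularAt R v) :
    ((boundaryGraph V R).neighborSet v).ncard = 2 := by
  have himg : Subtype.val '' ((boundaryGraph V R).neighborSet v) = (bdry R).neighborSet v.1 := by
    ext w
    constructor
    · rintro ⟨w, hw, rfl⟩
      exact hw
    · intro hw
      exact ⟨⟨w, (mem_of_bdry_adj hR hw).2⟩, hw, rfl⟩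
  rw [← Set.ncard_image_of_injective _ Subtype.val_injective, himg]
  obtain ⟨⟨x, y⟩, hvV⟩ := v
  have hN : ∀ w, w ∈ (bdry R).neighborSet (x, y) ↔ _ := fun w => bdry_adj_iff
  simp only [RegularAt] at hv
  rw [Set.ncard_eq_two]
  generalize (bdry R).neighborSet (x, y) = N at hN ⊢
  by_cases ha : (x, y) ∈ R <;> by_cases hb : (x - 1, y) ∈ R <;>
    by_cases hc : (x - 1, y - 1) ∈ R <;> by_cases hd : (x, y - 1) ∈ R <;>
    simp only [ha, hb, hc, hd, iff_true, iff_false, not_true, not_false_eq_true, and_true,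
      and_false, or_false, false_or, and_self, or_self] at hv hN
  all_goals
    exact ⟨_, _, by simp <;> omega, Set.ext hN⟩

theorem isCycles_boundaryGraph (hR : R ⊆ pixels V) (h : ∀ v ∈ V, RegularAt R v) :
    (boundaryGraph V R).IsCycles := fun v _ =>
  ncard_neighborSet_boundaryGraph hR v (h v v.2)

/-- The border of a face is connected: two vertices that touch the same nonpixel face are joined
along the boundary of the pixel region. The boundary edges in the component of `u` form a cycle,
and hence bound a two-colouring. The face is on one side of this cycle. By connectedness of the
grid graph all pixels are on its other side, and this is impossible at a vertex of the face that
is not on the cycle. -/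
theorem IsPolygonalThin.reachable_boundaryGraph (hV : IsPolygonalThin V) (u v : V)
    {c d : ℤ × ℤ} (hc : c ∉ pixels V) (huc : u.1 ∈ corners c) (hvd : v.1 ∈ corners d)
    (hcd : (cellGraph V).Reachable c d) : (boundaryGraph V (pixels V)).Reachable u v := by
  classical
  by_contra hnr
  let C : Set (ℤ × ℤ) := {w | ∃ hw : w ∈ V, (boundaryGraph V (pixels V)).Reachable u ⟨w, hw⟩}
  have hCstep : ∀ p q, (bdry (pixels V)).Adj p q → p ∈ C → q ∈ C := by
    rintro p q hpq ⟨hp, hr⟩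
    have hq := (mem_of_bdry_adj subset_rfl hpq).2
    exact ⟨hq, hr.trans (SimpleGraph.Adj.reachable (G := boundaryGraph V (pixels V))
      (u := ⟨p, hp⟩) (v := ⟨q, hq⟩) hpq)⟩
  have hCiff : ∀ p q, (bdry (pixels V)).Adj p q → (p ∈ C ↔ q ∈ C) := fun p q h =>
    ⟨hCstep p q h, hCstep q p h.symm⟩
  let h : ℤ × ℤ → ZMod 2 := fun c =>
    if (bdry (pixels V)).Adj c (c.1 + 1, c.2) ∧ c ∈ C then 1 else 0
  let t : ℤ × ℤ → ZMod 2 := fun c =>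
    if (bdry (pixels V)).Adj c (c.1, c.2 + 1) ∧ c ∈ C then 1 else 0
  -- indicator functions of the pixels and of the component `C`
  let p : ℤ × ℤ → ZMod 2 := fun c => if c ∈ pixels V then 1 else 0
  let ε : ℤ × ℤ → ZMod 2 := fun c => if c ∈ C then 1 else 0
  have two : (2 : ZMod 2) = 0 := rfl
  have eh : ∀ x y, h (x, y) = ε (x, y) * (p (x, y) + p (x, y - 1)) := by
    intro x y
    simp only [h, p, ε, bdry_adj_right]
    split_ifs <;> tauto
  have et : ∀ x y, t (x, y) = ε (x, y) * (p (x, y) + p (x - 1, y)) := by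
    intro x y
    simp only [t, p, ε, bdry_adj_up]
    split_ifs <;> tauto
  have eh' : ∀ x y, h (x - 1, y) = ε (x, y) * (p (x - 1, y) + p (x - 1, y - 1)) := by
    intro x y
    rw [eh]
    by_cases ha : (bdry (pixels V)).Adj (x - 1, y) (x - 1 + 1, y)
    · have := hCiff _ _ ha
      rw [sub_add_cancel] at this
      simp only [ε, this]
    · have := bdry_adj_right.not_left.1 ha
      simp only [p, this, CharTwo.add_self_eq_zero, mul_zero]
  have et' : ∀ x y, t (x, y - 1) = ε (x, y) * (p (x, y - 1) + p (x - 1, y - 1)) := by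
    intro x y
    rw [et]
    by_cases ha : (bdry (pixels V)).Adj (x, y - 1) (x, y - 1 + 1)
    · have := hCiff _ _ ha
      rw [sub_add_cancel] at this
      simp only [ε, this]
    · have := bdry_adj_up.not_left.1 ha
      simp only [p, this, CharTwo.add_self_eq_zero, mul_zero]
  have hh : ∀ x y, h (x, y) ≠ 0 → (x, y) ∈ V ∧ (x + 1, y) ∈ V := by
    intro x y hn
    exact mem_of_bdry_adj subset_rfl (by_contra fun ha => hn (if_neg fun h => ha h.1))
  have ht : ∀ x y, t (x, y) ≠ 0 → (x, y) ∈ V ∧ (x, y + 1) ∈ V := by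
    intro x y hn
    exact mem_of_bdry_adj subset_rfl (by_contra fun ha => hn (if_neg fun h => ha h.1))
  obtain ⟨M, hM⟩ : ∃ M : ℤ, ∀ c ∈ V, M < c.1 := by
    obtain ⟨M, hM⟩ := (V.image Prod.fst).bddBelow
    exact ⟨M - 1, fun c hcV => by
      have := hM (Finset.mem_coe.2 (Finset.mem_image_of_mem Prod.fst hcV)); omega⟩
  obtain ⟨κ, h1, h2⟩ := exists_coloring h t M
    (fun p q hp => ⟨by_contra fun hn => by have := hM _ (hh p q hn).1; simp at this; omega,
      by_contra fun hn => by have := hM _ (ht p q hn).1; simp at this; omega⟩)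
    (fun x y => by
      rw [eh, et, eh', et']
      linear_combination ε (x, y) * (p (x, y) + p (x, y - 1) + p (x - 1, y) + p (x - 1, y - 1))
        * two)
  have hκ : ∀ {c d}, (cellGraph V).Reachable c d → κ c = κ d := fun hr =>
    coloring_eq_of_reachable hh ht h1 h2 hr
  -- around a vertex of `C` the colour is that of membership in the region, up to a constant
  have around : ∀ w c, w ∈ corners c → κ c + ε w * p c = κ w + ε w * p w := by
    rintro ⟨x, y⟩ c hc
    have a1 := h1 x y
    have a2 := h2 x y
    have a3 := h2 (x - 1) y
    rw [et] at a1
    rw [eh] at a2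
    rw [eh'] at a3
    rcases mem_corners_iff_cell.1 hc with rfl | rfl | rfl | rfl
    · rfl
    · linear_combination -a1 - ε (x, y) * p (x, y) * two
    · linear_combination -a1 - a3 - ε (x, y) * (p (x, y) + p (x - 1, y)) * two
    · linear_combination -a2 - ε (x, y) * p (x, y) * two
  have pix : ∀ c ∈ pixels V, p c = 1 := fun c hc => if_pos hc
  have npix : ∀ c ∉ pixels V, p c = 0 := fun c hc => if_neg hc
  have same : ∀ w c d, w ∈ corners c → w ∈ corners d → c ∈ pixels V → d ∈ pixels V →
      κ c = κ d := by
    intro w c d hwc hwd hc hd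
    have e := (around w c hwc).trans (around w d hwd).symm
    rw [pix c hc, pix d hd] at e
    exact add_right_cancel e
  -- the colour of the pixels spreads along the edges of the grid graph, as each is in a pixel
  have prop : ∀ w : V, ∀ c ∈ pixels V, w.1 ∈ corners c → κ c = κ d + 1 := by
    intro w
    have hr := hV.connected.preconnected u w
    rw [SimpleGraph.reachable_iff_reflTransGen] at hr
    induction hr with
    | refl =>
      intro c' hc' huc'
      have e := (around u c' huc').trans (around u c huc).symm
      rw [pix c' hc', npix c hc, show ε u = 1 from if_pos ⟨u.2, by rfl⟩, hκ hcd] at e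
      linear_combination e - two
    | @tail a b _ hab ih =>
      intro c' hc' hbc'
      obtain ⟨e, he, hae, hbe⟩ := hV.exists_pixel_of_adj a.2 b.2 hab
      rw [same b c' e hbc' hbe hc' he]
      exact ih e he hae
  obtain ⟨e, he, hve⟩ := hV.exists_pixel v.2
  have e1 := prop v e he hve
  have e2 := (around v e hve).trans (around v d hvd).symm
  rw [show ε v = 0 from if_neg fun ⟨_, hr⟩ => hnr hr, e1] at e2
  simp at e2

/-! ### Exits of faces -/

open SimpleGraph

/-- The cells to the right of all vertices lie in the same face. -/
theorem reachable_of_lt_fst {N : ℤ} (hN : ∀ v ∈ V, v.1 ≤ N) {c d : ℤ × ℤ} (hc : N < c.1)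
    (hd : N < d.1) : (cellGraph V).Reachable c d := by
  have out : ∀ x y, N < x → (x, y) ∉ V := fun x y hx h => by
    have := hN _ h
    simp only at this
    omega
  have up : ∀ x y, N < x → ∀ n : ℕ, (cellGraph V).Reachable (x, y) (x, y + n) := by
    intro x y hx n
    induction n with
    | zero => simp
    | succ n ih =>
      refine ih.trans (Adj.reachable ?_)
      have := cellGraph_adj_down (V := V) (x := x) (y := y + (n + 1 : ℕ))
      rw [show y + ((n + 1 : ℕ) : ℤ) - 1 = y + n by push_cast; ring] at this
      exact this.2 fun h => out _ _ hx h.1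
  have right : ∀ x y, N < x → ∀ n : ℕ, (cellGraph V).Reachable (x, y) (x + n, y) := by
    intro x y hx n
    induction n with
    | zero => simp
    | succ n ih =>
      refine ih.trans (Adj.reachable ?_)
      have := cellGraph_adj_left (V := V) (x := x + (n + 1 : ℕ)) (y := y)
      rw [show x + ((n + 1 : ℕ) : ℤ) - 1 = x + n by push_cast; ring] at this
      exact this.2 fun h => out _ _ (by push_cast; omega) h.1
  have vert : ∀ x y z, N < x → (cellGraph V).Reachable (x, y) (x, z) := by
    intro x y z hx
    rcases le_total y z with h | h
    · simpa [h] using up x y hx (z - y).toNat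
    · simpa [h] using (up x z hx (y - z).toNat).symm
  have hor : ∀ x x' y, N < x → N < x' → (cellGraph V).Reachable (x, y) (x', y) := by
    intro x x' y hx hx'
    rcases le_total x x' with h | h
    · simpa [h] using right x y hx (x' - x).toNat
    · simpa [h] using (right x' y hx' (x - x').toNat).symm
  exact (vert c.1 c.2 d.2 hc).trans (hor c.1 d.1 d.2 hc hd)

/-- The cell `q` is an exit of the face `f`: it is a rightmost cell of `f`, and the cell to the
right of `q` is a pixel that continues upwards and downwards in pixels and has a cell of another
face on its right. -/
structure IsExit (f : Face V) (q : ℤ × ℤ) : Prop where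
  mem_supp : q ∈ f.supp
  not_mem_pixels : q ∉ pixels V
  le_fst : ∀ d ∈ f.supp, d.1 ≤ q.1
  right : (q.1 + 1, q.2) ∈ pixels V
  right_up : (q.1 + 1, q.2 + 1) ∈ pixels V
  right_down : (q.1 + 1, q.2 - 1) ∈ pixels V
  right_right : (q.1 + 2, q.2) ∉ pixels V

/-- A rightmost cell of the face has a corner outside `V`, which makes the right end of the face at
least two cells high. The two pixels to its right cannot both have a pixel on their right, since
their common vertex on that side is a boundary vertex; one of them gives the exit. -/
theorem IsPolygonalThin.exists_isExit (hV : IsPolygonalThin V) {f : Face V} {c₀ : ℤ × ℤ}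
    (hc₀ : c₀ ∉ pixels V) (hf : c₀ ∈ f.supp) {N : ℤ} (hN : ∀ d ∈ f.supp, d.1 ≤ N) :
    ∃ q, IsExit f q := by
  obtain ⟨X, ⟨⟨X', y₀⟩, hc, hX'⟩, hmax⟩ := Int.exists_greatest_of_bdd
    (P := fun x => ∃ c ∈ f.supp, c.1 = x) ⟨N, fun z ⟨c, hc, e⟩ => e ▸ hN c hc⟩ ⟨_, c₀, hf, rfl⟩
  obtain rfl : X' = X := hX'
  have hnp : ∀ d ∈ f.supp, d ∉ pixels V := fun d hd =>
    not_mem_pixels_of_reachable hc₀ (ConnectedComponent.exact (hf.trans hd.symm))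
  have hmem : ∀ {c d}, c ∈ f.supp → (cellGraph V).Reachable c d → d ∈ f.supp := fun hc hr =>
    (ConnectedComponent.sound hr.symm).trans hc
  have hle : ∀ d ∈ f.supp, d.1 ≤ X' := fun d hd => hmax _ ⟨d, hd, rfl⟩
  -- the cell to the right of a rightmost cell is a pixel, and so are those above and below it
  have hright : ∀ y, (X', y) ∈ f.supp → (X' + 1, y) ∈ pixels V := by
    intro y hy
    have hE : (X' + 1, y) ∈ V ∧ (X' + 1, y + 1) ∈ V := by
      by_contra hE
      have := hle _ (hmem hy (Adj.reachable (v := (X' + 1, y))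
        (by simpa using cellGraph_adj_left.2 hE)))
      simp at this
    obtain ⟨⟨a, b⟩, he, h1, h2⟩ := hV.exists_pixel_of_adj hE.1 hE.2
      (by simp [squareLattice_adj_iff])
    simp only [mem_corners] at h1 h2
    obtain rfl : b = y := by omega
    rcases h1.1 with h | h
    · rwa [h]
    · exact absurd he (by rw [show a = X' by omega]; exact hnp _ hy)
  have hup : ∀ y, (X', y) ∈ f.supp → (X' + 1, y + 1) ∈ pixels V := by
    intro y hy
    by_contra hn
    have := hle _ (hmem hy (hV.reachable_of_not_mem_pixels (mem_pixels.1 (hright y hy)).2.2.1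
      (hnp _ hy) hn (by simp [mem_corners]) (by simp [mem_corners])))
    simp at this
  have hdown : ∀ y, (X', y) ∈ f.supp → (X' + 1, y - 1) ∈ pixels V := by
    intro y hy
    by_contra hn
    have := hle _ (hmem hy (hV.reachable_of_not_mem_pixels (mem_pixels.1 (hright y hy)).1
      (hnp _ hy) hn (by simp [mem_corners]) (by simp [mem_corners])))
    simp at this
  have exit : ∀ y, (X', y) ∈ f.supp → (X' + 2, y) ∉ pixels V → ∃ q, IsExit f q := fun y hy hn =>
    ⟨(X', y), hy, hnp _ hy, hle, hright y hy, hup y hy, hdown y hy, hn⟩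
  -- a corner outside `V` is the middle of the right side of two rightmost cells
  obtain ⟨⟨a, y⟩, hw, hwV⟩ := Finset.not_subset.1 (hnp _ hc)
  have hcell : ∀ d, (a, y) ∈ corners d → d ∈ f.supp := fun d hd =>
    hmem hc (reachable_of_mem_corners hwV hw hd)
  obtain rfl : a = X' := by
    have h1 := hle _ (hcell (a, y) (by simp [mem_corners]))
    have h2 := (mem_corners.1 hw).1
    simp only at h1 h2
    omega
  have h1 := hcell (a, y) (by simp [mem_corners])
  have h2 := hcell (a, y - 1) (by simp [mem_corners])
  obtain ⟨e, he, hve⟩ := hV.exists_not_pixel (v := (a + 2, y))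
    (by have := (mem_pixels.1 (hright y h1)).2.1; rwa [add_assoc] at this)
  have e2 : a + 2 - 1 = a + 1 := by ring
  rcases mem_corners_iff_cell.1 hve with rfl | rfl | rfl | rfl
  · exact exit _ h1 he
  · exact absurd (hright y h1) (e2 ▸ he)
  · exact absurd (hright _ h2) (e2 ▸ he)
  · exact exit _ h2 he

/-! ### Merging the cycles of a 2-regular graph -/

/-- If `ab` and `cd` are edges in two different cycles of a 2-regular graph, then removing both keeps
each of the two cycles connected. -/
theorem reachable_of_flip {α : Type*} [Finite α] {K K' : SimpleGraph α} (hK : K.IsCycles)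
    {a b c d : α} (hab : K.Adj a b) (hcd : K.Adj c d) (hac : ¬ K.Reachable a c)
    (hK' : ∀ u v, K.Adj u v → s(u, v) ≠ s(a, b) → s(u, v) ≠ s(c, d) → K'.Adj u v)
    {u v : α} (huv : K.Reachable u v) : K'.Reachable u v := by
  have key : ∀ a b c d : α, K.Adj a b → K.Adj c d → ¬ K.Reachable a c →
      (∀ u v, K.Adj u v → s(u, v) ≠ s(a, b) → s(u, v) ≠ s(c, d) → K'.Adj u v) →
      K'.Reachable a b := by
    intro a b c d hab hcd hac hK'
    have main : ∀ z, Relation.ReflTransGen (K.deleteEdges {s(a, b)}).Adj a z →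
        K'.Reachable a z ∧ K.Reachable a z := by
      intro z hz
      induction hz with
      | refl => exact ⟨.rfl, .rfl⟩
      | @tail x y _ hxy ih =>
        have hxy' := deleteEdges_adj.1 hxy
        refine ⟨ih.1.trans (hK' _ _ hxy'.1 (by simpa using hxy'.2) ?_).reachable,
          ih.2.trans hxy'.1.reachable⟩
        intro e
        rcases Sym2.eq_iff.1 e with ⟨rfl, rfl⟩ | ⟨rfl, rfl⟩
        · exact hac ih.2
        · exact hac (ih.2.trans hcd.symm.reachable)
    exact (main b ((reachable_iff_reflTransGen _ _).1 (hK.reachable_deleteEdges hab))).1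
  have rab := key a b c d hab hcd hac hK'
  have rcd := key c d a b hcd hab (fun h => hac h.symm) fun u v h h1 h2 => hK' u v h h2 h1
  rw [reachable_iff_reflTransGen] at huv
  induction huv with
  | refl => rfl
  | @tail x y _ hxy ih =>
    refine ih.trans ?_
    by_cases h1 : s(x, y) = s(a, b)
    · rcases Sym2.eq_iff.1 h1 with ⟨rfl, rfl⟩ | ⟨rfl, rfl⟩
      exacts [rab, rab.symm]
    by_cases h2 : s(x, y) = s(c, d)
    · rcases Sym2.eq_iff.1 h2 with ⟨rfl, rfl⟩ | ⟨rfl, rfl⟩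
      exacts [rcd, rcd.symm]
    exact (hK' _ _ hxy h1 h2).reachable

/-- A connected 2-regular spanning subgraph is a Hamiltonian cycle. -/
theorem isHamiltonian_of_isCycles {α : Type*} [Fintype α] [DecidableEq α] {G K : SimpleGraph α}
    (hle : K ≤ G) (hK : K.IsCycles) (hc : K.Preconnected) {a b : α} (hab : K.Adj a b) :
    G.IsHamiltonian := by
  obtain ⟨p, hp, hv⟩ := hK.exists_cycle_toSubgraph_verts_eq_connectedComponentSupp
    (v := a) (c := K.connectedComponentMk a) rfl ⟨b, hab⟩
  intro _
  refine ⟨a, p.mapLe hle, ?_⟩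
  rw [Walk.isHamiltonianCycle_iff_isCycle_and_support_count_tail_eq_one]
  refine ⟨hp.mapLe hle, fun x => ?_⟩
  have hx : x ∈ p.support := by
    rw [← Walk.mem_verts_toSubgraph, hv]
    exact ConnectedComponent.sound (hc x a)
  have e : (p.mapLe hle).support = p.support := by simp
  rw [e]
  refine List.count_eq_one_of_mem hp.support_nodup ?_
  rw [← Walk.cons_tail_support] at hx
  rcases List.mem_cons.1 hx with rfl | hx
  · exact Walk.end_mem_tail_support hp.not_nil
  · exact hx

/-! ### Removing the exit pixels from the pixel region -/

/-- The pixel region without the pixels to the right of the cells of `S`. -/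
def cutRegion (V S : Finset (ℤ × ℤ)) : Set (ℤ × ℤ) :=
  {c | c ∈ pixels V ∧ (c.1 - 1, c.2) ∉ S}

theorem cutRegion_subset {S : Finset (ℤ × ℤ)} : cutRegion V S ⊆ pixels V := fun _ h => h.1

/-- Removing a cell with upper and lower neighbours in `R` deletes only vertical sides of the cell
from the boundary. -/
theorem bdry_adj_diff_singleton {R : Set (ℤ × ℤ)} {X Y : ℤ} (hp : (X + 1, Y) ∈ R)
    (hu : (X + 1, Y + 1) ∈ R) (hd : (X + 1, Y - 1) ∈ R) {u v : ℤ × ℤ} (h : (bdry R).Adj u v)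
    (h1 : s(u, v) ≠ s((X + 1, Y), (X + 1, Y + 1))) (h2 : s(u, v) ≠ s((X + 2, Y), (X + 2, Y + 1))) :
    (bdry (R \ {(X + 1, Y)})).Adj u v := by
  obtain ⟨hs, e, he, e', he', hue, hve⟩ := h
  refine ⟨hs, e, ⟨he, ?_⟩, e', fun h => he' h.1, hue, hve⟩
  rintro rfl
  obtain ⟨a, b⟩ := u
  obtain ⟨a', b'⟩ := e'
  simp only [mem_corners] at hue hve
  have hne : ∀ z : ℤ, (X + 1, z) ∈ R → a' = X + 1 → b' ≠ z := by
    rintro z hz rfl rfl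
    exact he' hz
  have hor : a' = X + 1 → False := fun ha => by
    have n1 := hne _ hp ha
    have n2 := hne _ hu ha
    have n3 := hne _ hd ha
    clear h1 h2
    omega
  have ver : ∀ c d : ℤ × ℤ, c.1 = d.1 → (c.1 = X + 1 ∨ c.1 = X + 2) →
      (c.2 = Y ∧ d.2 = Y + 1 ∨ c.2 = Y + 1 ∧ d.2 = Y) →
      s(c, d) = s((X + 1, Y), (X + 1, Y + 1)) ∨ s(c, d) = s((X + 2, Y), (X + 2, Y + 1)) := by
    rintro ⟨c1, c2⟩ ⟨d1, d2⟩ hcd h1 h2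
    simp only at hcd h1 h2
    subst hcd
    obtain rfl | rfl := h1 <;> obtain ⟨rfl, rfl⟩ | ⟨rfl, rfl⟩ := h2 <;> simp
  rcases squareLattice_adj_iff.1 hs with rfl | rfl | rfl | rfl <;> simp only at hue hve
  · exact hor (by omega)
  · exact hor (by omega)
  · exact (ver (a, b) (a, b + 1) rfl (by dsimp only; omega) (by dsimp only; omega)).elim h1 h2
  · exact (ver (a, b) (a, b - 1) rfl (by dsimp only; omega) (by dsimp only; omega)).elim h1 h2

/-- Removing a cell with left and right neighbours outside `R` adds only horizontal sides of the cell
to the boundary. -/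
theorem bdry_adj_of_diff_singleton {R : Set (ℤ × ℤ)} {X Y : ℤ}
    (hl : (X, Y) ∉ R) (hr : (X + 2, Y) ∉ R) {u v : ℤ × ℤ}
    (h : (bdry (R \ {(X + 1, Y)})).Adj u v) : (bdry R).Adj u v ∨
      s(u, v) = s((X + 1, Y), (X + 2, Y)) ∨ s(u, v) = s((X + 1, Y + 1), (X + 2, Y + 1)) := by
  obtain ⟨hs, e, he, e', he', hue, hve⟩ := h
  by_cases he'R : e' ∈ R
  · right
    obtain rfl : e' = (X + 1, Y) := by_contra fun hn => he' ⟨he'R, hn⟩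
    obtain ⟨a, b⟩ := u
    obtain ⟨a', b'⟩ := e
    have hne : ∀ z : ℤ, (z, Y) ∉ R → ¬ (a' = z ∧ b' = Y) := by
      rintro z hz ⟨rfl, rfl⟩
      exact hz he.1
    have n1 := hne _ hl
    have n2 := hne _ hr
    have n3 : ¬ (a' = X + 1 ∧ b' = Y) := fun h => he.2 (Prod.ext h.1 h.2)
    simp only [Sym2.eq_iff, Prod.mk.injEq]
    rcases squareLattice_adj_iff.1 hs with rfl | rfl | rfl | rfl <;>
      simp only [mem_corners, Prod.mk.injEq] at hue hve ⊢ <;> omega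
  · exact Or.inl ⟨hs, e, he.1, e', he'R, hue, hve⟩

theorem RegularAt.diff_singleton {R : Set (ℤ × ℤ)} {X Y : ℤ} (hl : (X, Y) ∉ R)
    (hr : (X + 2, Y) ∉ R) (hu : (X + 1, Y + 1) ∈ R) (hd : (X + 1, Y - 1) ∈ R) {v : ℤ × ℤ}
    (hv : RegularAt R v) : RegularAt (R \ {(X + 1, Y)}) v := by
  have e1 : X + 2 - 1 = X + 1 := by ring
  have hu' : (X + 1, Y + 1) ≠ (X + 1, Y) := by simp
  have hd' : (X + 1, Y - 1) ≠ (X + 1, Y) := by simp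
  by_cases hc : v ∈ corners (X + 1, Y)
  · obtain ⟨a, b⟩ := v
    rw [mem_corners] at hc
    simp only at hc
    rw [add_assoc, one_add_one_eq_two] at hc
    obtain ⟨rfl | rfl, rfl | rfl⟩ := hc <;>
      simp only [RegularAt, Set.mem_sdiff, Set.mem_singleton_iff, e1, add_sub_cancel_right, hl, hr,
        hu, hd, hu', hd', not_true, not_false_eq_true, and_true, and_false, true_and, false_and] <;>
      tauto
  · have key : ∀ c, v ∈ corners c → (c ∈ R \ {(X + 1, Y)} ↔ c ∈ R) := fun c hvc =>
      ⟨fun h => h.1, fun h => ⟨h, fun e => hc ((show c = _ from e) ▸ hvc)⟩⟩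
    unfold RegularAt
    rw [key v (by simp [mem_corners]), key (v.1 - 1, v.2) (by simp [mem_corners]),
      key (v.1 - 1, v.2 - 1) (by simp [mem_corners]), key (v.1, v.2 - 1) (by simp [mem_corners])]
    exact hv

/-- Removing the pixels at the exits in `S` keeps the boundary 2-regular and merges the border of
each face with an exit in `S` into the border of the face behind this exit. The map `r` records
which borders have been merged. It never moves a face to one that extends less far to the right;
therefore two borders that are about to be merged are still distinct. -/
theorem IsPolygonalThin.cutRegion_spec (hV : IsPolygonalThin V) (S : Finset (ℤ × ℤ))
    (hS : ∀ q ∈ S, IsExit ((cellGraph V).connectedComponentMk q) q)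
    (hinj : ∀ q ∈ S, ∀ q' ∈ S, (cellGraph V).Reachable q q' → q = q') :
    (∀ v ∈ V, RegularAt (cutRegion V S) v) ∧
    (∃ r : Face V → Face V, (∀ f, ∀ c ∈ f.supp, ∃ d ∈ (r f).supp, c.1 ≤ d.1) ∧
      (∀ f, (∀ q ∈ S, q ∉ f.supp) → r f = f) ∧
      ∀ u v : V, (boundaryGraph V (cutRegion V S)).Adj u v → ∀ c d, c ∉ pixels V → d ∉ pixels V →
        u.1 ∈ corners c → v.1 ∈ corners d →
        r ((cellGraph V).connectedComponentMk c) = r ((cellGraph V).connectedComponentMk d)) ∧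
    (∀ u v : V, (boundaryGraph V (pixels V)).Reachable u v →
      (boundaryGraph V (cutRegion V S)).Reachable u v) ∧
    ∀ q ∈ S, ∀ u v : V, u.1 = (q.1 + 1, q.2) → v.1 = (q.1 + 2, q.2) →
      (boundaryGraph V (cutRegion V S)).Reachable u v := by
  classical
  induction S using Finset.induction_on with
  | empty =>
    have e : cutRegion V ∅ = pixels V := by ext c; simp [cutRegion]
    rw [e]
    refine ⟨fun v hv => hV.regularAt_pixels hv, ⟨id, fun f c hc => ⟨c, hc, le_rfl⟩, fun _ _ => rfl,
      ?_⟩, fun u v h => h, by simp⟩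
    rintro u v ⟨-, -, -, e, he, -, hue, hve⟩ c d hc hd huc hvd
    exact ConnectedComponent.sound ((hV.reachable_of_not_mem_pixels u.2 hc he huc hue).trans
      (hV.reachable_of_not_mem_pixels v.2 he hd hve hvd))
  | insert q S hqS ih =>
    obtain ⟨hreg, ⟨r, hr1, hr2, hr3⟩, hreach, hexit⟩ := ih
      (fun q' h => hS q' (Finset.mem_insert_of_mem h))
      (fun q' h q'' h' => hinj q' (Finset.mem_insert_of_mem h) q'' (Finset.mem_insert_of_mem h'))
    have hq := hS q (Finset.mem_insert_self q S)
    have hqn : ∀ q' ∈ S, ¬ (cellGraph V).Reachable q q' := fun q' h hqq' => hqS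
      (hinj q (Finset.mem_insert_self q S) q' (Finset.mem_insert_of_mem h) hqq' ▸ h)
    obtain ⟨X, Y⟩ := q
    obtain ⟨-, hqP, hle, hp, hpu, hpd, hrr⟩ := hq
    simp only at hp hpu hpd hrr
    have e2 : X + 1 + 1 = X + 2 := by ring
    obtain ⟨ha, hc, hb, hd⟩ := mem_pixels.1 hp
    rw [e2] at hc hd
    -- the cells of `S` are neither above nor below `(X, Y)`, as those lie in the same face
    have hnS : ∀ z, (X, z) ∉ pixels V → ∀ w ∈ V, w ∈ corners (X, Y) → w ∈ corners (X, z) →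
        (X, z) ∉ S := fun z hz w hw h1 h2 hS' =>
      hqn _ hS' (hV.reachable_of_not_mem_pixels hw hqP hz h1 h2)
    have hSP : ∀ q' ∈ S, q' ∉ pixels V := fun q' h =>
      (hS q' (Finset.mem_insert_of_mem h)).not_mem_pixels
    have mp : (X + 1, Y) ∈ cutRegion V S := ⟨hp, by simpa using hqS⟩
    have mu : (X + 1, Y + 1) ∈ cutRegion V S := ⟨hpu, fun h => by
      rw [add_sub_cancel_right] at h
      exact hnS _ (hSP _ h) _ hb (by simp [mem_corners]) (by simp [mem_corners]) h⟩
    have md : (X + 1, Y - 1) ∈ cutRegion V S := ⟨hpd, fun h => by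
      rw [add_sub_cancel_right] at h
      exact hnS _ (hSP _ h) _ ha (by simp [mem_corners]) (by simp [mem_corners]) h⟩
    have ml : (X, Y) ∉ cutRegion V S := fun h => hqP h.1
    have mr : (X + 2, Y) ∉ cutRegion V S := fun h => hrr h.1
    -- the claim is about the boundary of `R \ {(X + 1, Y)}`, with `R` the region for `S`
    have hR : cutRegion V (insert (X, Y) S) = cutRegion V S \ {(X + 1, Y)} := by
      ext ⟨x, y⟩
      simp only [cutRegion, Set.mem_ofPred_eq, Finset.mem_insert, Set.mem_sdiff,
        Set.mem_singleton_iff, Prod.mk.injEq, sub_eq_iff_eq_add]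
      tauto
    rw [hR]
    have hRP : cutRegion V S ⊆ pixels V := cutRegion_subset
    clear hR
    generalize cutRegion V S = R at *
    obtain ⟨A, hA⟩ : ∃ A : V, A.1 = (X + 1, Y) := ⟨⟨_, ha⟩, rfl⟩
    obtain ⟨B, hB⟩ : ∃ B : V, B.1 = (X + 1, Y + 1) := ⟨⟨_, hb⟩, rfl⟩
    obtain ⟨C, hC⟩ : ∃ C : V, C.1 = (X + 2, Y) := ⟨⟨_, hc⟩, rfl⟩
    obtain ⟨D, hD⟩ : ∃ D : V, D.1 = (X + 2, Y + 1) := ⟨⟨_, hd⟩, rfl⟩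
    have adjAB : (boundaryGraph V R).Adj A B := by
      change (bdry R).Adj A.1 B.1
      rw [hA, hB, bdry_adj_up, add_sub_cancel_right]
      simp [mp, ml]
    have adjCD : (boundaryGraph V R).Adj C D := by
      change (bdry R).Adj C.1 D.1
      rw [hC, hD, bdry_adj_up, show X + 2 - 1 = X + 1 by ring]
      simp [mp, mr]
    have adjAC : (boundaryGraph V (R \ {(X + 1, Y)})).Adj A C := by
      change (bdry _).Adj A.1 C.1
      rw [hA, hC]
      have : (bdry (R \ {(X + 1, Y)})).Adj (X + 1, Y) (X + 1 + 1, Y) := bdry_adj_right.2 (by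
        simp [md])
      rwa [e2] at this
    have hrconst : ∀ u v : V, (boundaryGraph V R).Reachable u v → ∀ c d, c ∉ pixels V →
        d ∉ pixels V → u.1 ∈ corners c → v.1 ∈ corners d →
        r ((cellGraph V).connectedComponentMk c) = r ((cellGraph V).connectedComponentMk d) := by
      intro u v huv c d hc hd huc hvd
      rw [reachable_iff_reflTransGen] at huv
      induction huv generalizing d with
      | refl =>
        rw [ConnectedComponent.sound (hV.reachable_of_not_mem_pixels u.2 hc hd huc hvd)]
      | @tail v w _ hvw ih =>
        obtain ⟨e, he, hve⟩ := hV.exists_not_pixel v.2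
        exact (ih e he hve).trans (hr3 v w hvw e d he hd hve hvd)
    have hrq : r ((cellGraph V).connectedComponentMk (X, Y)) =
        (cellGraph V).connectedComponentMk (X, Y) :=
      hr2 _ fun q' hq' h => hqn q' hq' (ConnectedComponent.exact h).symm
    obtain ⟨d', hd', hXd'⟩ := hr1 ((cellGraph V).connectedComponentMk (X + 2, Y)) _ rfl
    have hnAC : ¬ (boundaryGraph V R).Reachable A C := by
      intro h
      have e := hrconst A C h (X, Y) (X + 2, Y) hqP hrr (by simp [hA, mem_corners])
        (by simp [hC, mem_corners])
      rw [← e, hrq] at hd'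
      have := hle _ hd'
      simp only at this hXd'
      omega
    have hflip : ∀ u v : V, (boundaryGraph V R).Reachable u v →
        (boundaryGraph V (R \ {(X + 1, Y)})).Reachable u v := fun u v =>
      reachable_of_flip (isCycles_boundaryGraph hRP hreg) adjAB adjCD hnAC
        fun u v huv h1 h2 => bdry_adj_diff_singleton mp mu md huv
          (fun e => h1 (Sym2.map.injective Subtype.val_injective (by simpa [hA, hB] using e)))
          (fun e => h2 (Sym2.map.injective Subtype.val_injective (by simpa [hC, hD] using e)))
    refine ⟨fun v hv => (hreg v hv).diff_singleton ml mr mu md,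
      ⟨fun f => if r f = (cellGraph V).connectedComponentMk (X, Y) then
        r ((cellGraph V).connectedComponentMk (X + 2, Y)) else r f, ?_, ?_, ?_⟩,
      fun u v h => hflip u v (hreach u v h), ?_⟩
    · intro f c hcf
      obtain ⟨d, hd, hcd⟩ := hr1 f c hcf
      dsimp only
      split_ifs with hf
      · have := hle d (hf ▸ hd)
        exact ⟨d', hd', by simp only at this hXd'; omega⟩
      · exact ⟨d, hd, hcd⟩
    · intro f hf
      have hf' := hr2 f fun q' hq' => hf q' (Finset.mem_insert_of_mem hq')
      dsimp only
      rw [hf', if_neg]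
      rintro rfl
      exact hf _ (Finset.mem_insert_self _ _) rfl
    · intro u v huv c d hcP hdP huc hvd
      -- the ends of an inserted edge touch the face of the exit and the face behind it
      have face_eq : ∀ w z c : ℤ × ℤ, w ∈ V → w ∈ corners z → w ∈ corners c → z ∉ pixels V →
          c ∉ pixels V → (cellGraph V).connectedComponentMk c =
            (cellGraph V).connectedComponentMk z := fun w z c hw h1 h2 h3 h4 =>
        ConnectedComponent.sound (hV.reachable_of_not_mem_pixels hw h4 h3 h2 h1)
      have new : ∀ c d : ℤ × ℤ,
          (cellGraph V).connectedComponentMk c = (cellGraph V).connectedComponentMk (X, Y) →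
          (cellGraph V).connectedComponentMk d = (cellGraph V).connectedComponentMk (X + 2, Y) →
          (if r ((cellGraph V).connectedComponentMk c) =
              (cellGraph V).connectedComponentMk (X, Y) then
            r ((cellGraph V).connectedComponentMk (X + 2, Y)) else
            r ((cellGraph V).connectedComponentMk c)) =
          if r ((cellGraph V).connectedComponentMk d) =
              (cellGraph V).connectedComponentMk (X, Y) then
            r ((cellGraph V).connectedComponentMk (X + 2, Y)) else
            r ((cellGraph V).connectedComponentMk d) := by
        intro c d h1 h2
        rw [h1, h2, hrq, if_pos rfl, ite_self]
      rcases bdry_adj_of_diff_singleton ml mr huv with h | h | h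
      · simp only [hr3 u v h c d hcP hdP huc hvd]
      · rcases Sym2.eq_iff.1 h with ⟨h1, h2⟩ | ⟨h1, h2⟩
        · exact new c d (face_eq _ _ _ u.2 (by simp [h1, mem_corners]) huc hqP hcP)
            (face_eq _ _ _ v.2 (by simp [h2, mem_corners]) hvd hrr hdP)
        · exact (new d c (face_eq _ _ _ v.2 (by simp [h2, mem_corners]) hvd hqP hdP)
            (face_eq _ _ _ u.2 (by simp [h1, mem_corners]) huc hrr hcP)).symm
      · rcases Sym2.eq_iff.1 h with ⟨h1, h2⟩ | ⟨h1, h2⟩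
        · exact new c d (face_eq _ _ _ u.2 (by simp [h1, mem_corners]) huc hqP hcP)
            (face_eq _ _ _ v.2 (by simp [h2, mem_corners]) hvd hrr hdP)
        · exact (new d c (face_eq _ _ _ v.2 (by simp [h2, mem_corners]) hvd hqP hdP)
            (face_eq _ _ _ u.2 (by simp [h1, mem_corners]) huc hrr hcP)).symm
    · intro q' hq' u v hu hv
      rcases Finset.mem_insert.1 hq' with rfl | hq'
      · obtain rfl : u = A := Subtype.ext (hu.trans hA.symm)
        obtain rfl : v = C := Subtype.ext (hv.trans hC.symm)
        exact adjAC.reachable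
      · exact hflip u v (hexit q' hq' u v hu hv)

/-- After the pixels at one exit for each face other than the outer one have been removed, the
boundary of the region that remains is a Hamiltonian cycle. -/
theorem IsPolygonalThin.isHamiltonian (hV : IsPolygonalThin V) : (graph V).IsHamiltonian := by
  classical
  obtain ⟨N, hN⟩ : ∃ N : ℤ, ∀ c ∈ V, c.1 ≤ N := by
    obtain ⟨N, hN⟩ := (V.image Prod.fst).bddAbove
    exact ⟨N, fun c hcV => hN (Finset.mem_coe.2 (Finset.mem_image_of_mem Prod.fst hcV))⟩
  let mk : ℤ × ℤ → Face V := (cellGraph V).connectedComponentMk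
  let o : Face V := mk (N + 1, 0)
  have ho : ∀ c : ℤ × ℤ, N < c.1 → mk c = o := fun c hc =>
    ConnectedComponent.sound (reachable_of_lt_fst hN hc (by simp))
  have hex : ∀ f : Face V, ∃ q : ℤ × ℤ, ∀ c ∈ f.supp, c ∉ pixels V → f ≠ o → IsExit f q := by
    intro f
    by_cases hf : ∃ c ∈ f.supp, c ∉ pixels V ∧ f ≠ o
    · obtain ⟨c, hc, hcP, hfo⟩ := hf
      obtain ⟨q, hq⟩ := hV.exists_isExit (N := N) hcP hc fun d hd => by
        by_contra hn
        exact hfo (hd.symm.trans (ho d (by omega)))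
      exact ⟨q, fun _ _ _ _ => hq⟩
    · exact ⟨0, fun c hc hcP hfo => absurd ⟨c, hc, hcP, hfo⟩ hf⟩
  choose q hq using hex
  choose e heP hve using fun v : V => hV.exists_not_pixel v.2
  have hqe : ∀ v, mk (e v) ≠ o → IsExit (mk (e v)) (q (mk (e v))) := fun v hv =>
    hq _ (e v) rfl (heP v) hv
  let S : Finset (ℤ × ℤ) := (Finset.univ.filter fun v => mk (e v) ≠ o).image fun v => q (mk (e v))
  have hSmem : ∀ x ∈ S, ∃ v, mk (e v) ≠ o ∧ q (mk (e v)) = x := fun x hx => by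
    simpa [S] using hx
  obtain ⟨hreg, -, hreach, hexit⟩ := hV.cutRegion_spec S
    (fun x hx => by
      obtain ⟨v, hv, rfl⟩ := hSmem x hx
      have h := hqe v hv
      rwa [show (cellGraph V).connectedComponentMk (q (mk (e v))) = mk (e v) from h.mem_supp])
    (fun x hx y hy hxy => by
      obtain ⟨v, hv, rfl⟩ := hSmem x hx
      obtain ⟨w, hw, rfl⟩ := hSmem y hy
      have h1 : mk (q (mk (e v))) = mk (e v) := (hqe v hv).mem_supp
      have h2 : mk (q (mk (e w))) = mk (e w) := (hqe w hw).mem_supp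
      have h3 : mk (q (mk (e v))) = mk (q (mk (e w))) := ConnectedComponent.sound hxy
      rw [h1, h2] at h3
      rw [h3])
  have hsame : ∀ (u v : V) (c d : ℤ × ℤ), c ∉ pixels V → u.1 ∈ corners c → v.1 ∈ corners d →
      mk c = mk d → (boundaryGraph V (cutRegion V S)).Reachable u v := fun u v c d hc huc hvd h =>
    hreach u v (hV.reachable_boundaryGraph u v hc huc hvd (ConnectedComponent.exact h))
  -- following the exits to the right, every vertex is joined to the border of the outer face
  have hout : ∀ n : ℕ, ∀ (v : V) (c c' : ℤ × ℤ), c ∉ pixels V → v.1 ∈ corners c → mk c' = mk c →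
      N + 1 ≤ c'.1 + n → ∃ (w : V) (d : ℤ × ℤ), d ∉ pixels V ∧ w.1 ∈ corners d ∧ mk d = o ∧
        (boundaryGraph V (cutRegion V S)).Reachable v w := by
    intro n
    induction n with
    | zero =>
      intro v c c' hc hvc hc' hn
      exact ⟨v, c, hc, hvc, hc'.symm.trans (ho c' (by simpa using hn)), .rfl⟩
    | succ n ih =>
      intro v c c' hc hvc hc' hn
      have hce : mk c = mk (e v) := ConnectedComponent.sound
        (hV.reachable_of_not_mem_pixels v.2 hc (heP v) hvc (hve v))
      by_cases hco : mk c = o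
      · exact ⟨v, c, hc, hvc, hco, .rfl⟩
      have hx := hqe v (hce ▸ hco)
      have hxS : q (mk (e v)) ∈ S := by
        simp only [S, Finset.mem_image, Finset.mem_filter, Finset.mem_univ, true_and]
        exact ⟨v, hce ▸ hco, rfl⟩
      generalize q (mk (e v)) = x at hx hxS
      obtain ⟨X, Y⟩ := x
      have hle := hx.le_fst c' (hc'.trans hce)
      obtain ⟨ha, hb, -, -⟩ := mem_pixels.1 hx.right
      rw [add_assoc, one_add_one_eq_two] at hb
      obtain ⟨w, d, hd, hwd, hdo, hr⟩ := ih ⟨_, hb⟩ (X + 2, Y) (X + 2, Y) hx.right_right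
        (by simp [mem_corners]) rfl (by push_cast at hn; simp only at hle ⊢; omega)
      refine ⟨w, d, hd, hwd, hdo, .trans ?_ ((hexit _ hxS ⟨_, ha⟩ ⟨_, hb⟩ rfl rfl).trans hr)⟩
      exact hsame v _ c (X, Y) hc hvc (by simp [mem_corners]) (hce.trans hx.mem_supp.symm)
  have hout' : ∀ v : V, ∃ (w : V) (d : ℤ × ℤ), d ∉ pixels V ∧ w.1 ∈ corners d ∧ mk d = o ∧
      (boundaryGraph V (cutRegion V S)).Reachable v w := fun v =>
    hout (N + 1 - (e v).1).toNat v (e v) (e v) (heP v) (hve v) rfl (by omega)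
  have hpre : (boundaryGraph V (cutRegion V S)).Preconnected := by
    intro u v
    obtain ⟨u', c, hc, huc, hco, hu⟩ := hout' u
    obtain ⟨v', d, hd, hvd, hdo, hv⟩ := hout' v
    exact hu.trans ((hsame u' v' c d hc huc hvd (hco.trans hdo.symm)).trans hv.symm)
  obtain ⟨v⟩ := hV.connected.nonempty
  have h2 := ncard_neighborSet_boundaryGraph cutRegion_subset v (hreg v v.2)
  obtain ⟨w, hw⟩ := Set.nonempty_of_ncard_ne_zero (h2 ▸ two_ne_zero)
  exact isHamiltonian_of_isCycles boundaryGraph_le (isCycles_boundaryGraph cutRegion_subset hreg)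
    hpre hw

end SquareGrid

/-! ### A Turing machine that accepts every input -/

open Turing in
/-- The machine with one input stack (`false`) and one output stack (`true`) that empties the input
stack and then pushes `true`. Its state remembers whether the last pop found a letter. -/
def emptyAndAccept (Γ : Type) [Fintype Γ] : FinTM2 where
  K := Bool
  k₀ := false
  k₁ := true
  Γ k := bif k then Bool else Γ
  Λ := Unit
  main := ()
  σ := Bool
  initialState := false
  Γk₀Fin := inferInstanceAs (Fintype Γ)
  m _ := .pop false (fun _ a => a.isSome) <| .branch id (.goto fun _ => ())
    (.push true (fun _ => true) .halt)

namespace Turing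

/-- The stacks of `emptyAndAccept Γ` with the word `l` left on the input stack and an empty output
stack. -/
def inputStacks {Γ : Type} [Fintype Γ] (l : List Γ) : ∀ k, List ((emptyAndAccept Γ).Γ k)
  | false => l
  | true => []

theorem emptyAndAccept_steps {Γ : Type} [Fintype Γ] (l : List Γ) (b : Bool) :
    (flip bind (emptyAndAccept Γ).step)^[l.length + 1]
      (some (⟨some (), b, inputStacks l⟩ : (emptyAndAccept Γ).Cfg)) =
      some (haltList (emptyAndAccept Γ) [true]) := by
  induction l generalizing b with
  | nil =>
    have h : (emptyAndAccept Γ).step (⟨some (), b, inputStacks []⟩ : (emptyAndAccept Γ).Cfg) =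
        some (haltList (emptyAndAccept Γ) [true]) := by
      refine congrArg (fun S => some (⟨none, false, S⟩ : (emptyAndAccept Γ).Cfg)) ?_
      funext k
      cases k <;> rfl
    exact h
  | cons a l ih =>
    have h : (emptyAndAccept Γ).step
        (⟨some (), b, inputStacks (a :: l)⟩ : (emptyAndAccept Γ).Cfg) =
        some (⟨some (), true, inputStacks l⟩ : (emptyAndAccept Γ).Cfg) := by
      refine congrArg (fun S => some (⟨some (), true, S⟩ : (emptyAndAccept Γ).Cfg)) ?_
      funext k
      cases k <;> rfl
    rw [List.length_cons, Function.iterate_succ_apply]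
    exact (congrArg _ h).trans (ih true)

theorem nonempty_tm2ComputableInPolyTime_alwaysAccept {α Γ : Type} [Fintype Γ]
    (enc : α → List Γ) :
    Nonempty (TM2ComputableInPolyTime enc Computability.encodeBool (alwaysAccept (α := α))) := by
  refine ⟨⟨⟨emptyAndAccept Γ, Equiv.refl _, Equiv.refl _⟩, Polynomial.X + 1, fun a =>
    ⟨⟨(enc a).length + 1, ?_⟩, by simp⟩⟩⟩
  have h : initList (emptyAndAccept Γ) (enc a) =
      (⟨some (), false, inputStacks (enc a)⟩ : (emptyAndAccept Γ).Cfg) := by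
    refine congrArg (fun S => (⟨some (), false, S⟩ : (emptyAndAccept Γ).Cfg)) ?_
    funext k
    cases k <;> rfl
  have e : (enc a).map (Equiv.refl Γ).invFun = enc a := List.map_id _
  exact (congrArg _ (congrArg some ((congrArg (initList (emptyAndAccept Γ)) e).trans h))).trans
    (emptyAndAccept_steps (enc a) false)

end Turing

/-- Every square polygonal thin grid graph is Hamiltonian; and the `always accept` algorithm decides
in polynomial time, for every encoding of such graphs by strings over a finite alphabet, whether a
given one is Hamiltonian. -/
theorem mainTheorem4 :
    (∀ V : Finset (ℤ × ℤ), (SquareGrid.graph V).Connected → SquareGrid.HasNoCutVertex V →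
      SquareGrid.IsPolygonal V → SquareGrid.IsThin V → (SquareGrid.graph V).IsHamiltonian) ∧
    (∀ (Γ : Type) [Fintype Γ] (enc : Computability.Encoding SquareGrid.PolygonalThin Γ),
      DecidesInPolyTime enc alwaysAccept
        (fun V => (SquareGrid.graph V.1).IsHamiltonian)) := by
  have ham : ∀ V : Finset (ℤ × ℤ), SquareGrid.IsPolygonalThin V →
      (SquareGrid.graph V).IsHamiltonian := fun V hV => by
    convert hV.isHamiltonian
  exact ⟨fun V h1 h2 h3 h4 => ham V ⟨h1, h2, h3, h4⟩, fun Γ _ enc =>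
    ⟨fun V => ⟨fun _ => ham V.1 V.2, fun _ => rfl⟩,
      Turing.nonempty_tm2ComputableInPolyTime_alwaysAccept enc.encode⟩⟩
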